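/- **Setting.** Let $1\to\mathbb T\to\tilde K\xrightarrow{q}K\to 1$ be a central extension of Lie groups by the circle group ($q$ being a principal $\mathbb T$-bundle), with Lie algebras $\mathfrak t\subset\tilde{\mathfrak k}\to\mathfrak k$ and left-invariant Maurer–Cartan forms $\tilde\mu,\mu$ of $\tilde K,K$. Let $\pi:P\to X$ be a smooth principal $K$-bundle with connection form $A\in\Omega^1(P,\mathfrak k)$, and let $\sigma:\mathfrak k\to\tilde{\mathfrak k}$ be a (continuous) linear splitting of $\tilde{\mathfrak k}\to\mathfrak k$. Since $\mathbb T$ is central, the adjoint action of $\tilde K$ on $\tilde{\mathfrak k}$ descends to an action $\mathrm{Ad}$ of $K$ on $\tilde{\mathfrak k}$. Let $P^{[2]}=P\times_XP$ with projections $\pi_1,\pi_2:P^{[2]}\to P$, and let $\xi:P^{[2]}\to K$ be $\xi(p,pk)=k$. The lifting bundle gerbe $\mathbb L_P^{\tilde K}$ is the circle bundle $J=\xi^*\tilde K\cong P\times\tilde K$ with $\rho:J\to P^{[2]}$, $\rho(p,\tilde k)=(p,p\,q(\tilde k))$, and $\tilde\xi:J\to\tilde K$, $\tilde\xi(p,\tilde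 k)=\tilde k$, together with the multiplication $m\big((p,\tilde k_1),(p\,q(\tilde k_1),\tilde k_2)\big)=(p,\tilde k_1\tilde k_2)$. The group $\tilde K$ acts on $J$ by right multiplication on the second factor, making $\pi_1\circ\rho:J\to P$ a principal $\tilde K$-bundle. Put $$\nu_\sigma=\tilde\mu-\sigma(q^*\mu)\in\Omega^1(\tilde K,\mathfrak t),\qquad Z_\sigma(k,\zeta)=\mathrm{Ad}_k\sigma(\zeta)-\sigma(\mathrm{Ad}_k\zeta)\in\mathfrak t\quad(k\in K,\ \zeta\in\mathfrak k),$$ and let $$\nabla_{A,\sigma}=\tilde\xi^*\nu_\sigma+\rho^*Z_\sigma(\xi^{-1},\pi_1^*A)$$ be the Gomi connection on $J\to P^{[2]}$, a $\mathfrak t$-valued form, regarded below as a $\tilde{\mathfrak k}$-valued form. **Proposition (principal module connection).** The form $\rho^*\mathrm{Ad}_{\xi^{-1}}\sigma(\pi_1^*A)$ on $J$ is smooth, horizontal and $\mathrm{Ad}$-equivariant for the principal $\tilde K$-bundle $J\to P$ (equivalently, it is a one-form on $P$ with values in the adjoint bundle of $J\to P$), and $$\phi_{A,\sigma}=\tilde\xi^*\tilde\mu+\rho^*\,\mathrm{Ad}_{\xi^{-1}}\sigma(\pi_1^*A)\in\Omega^1(J,\tilde{\mathfrak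 k})$$ is a bundle gerbe module connection on $J\to P$ compatible with $\nabla_{A,\sigma}$. That is, $\phi_{A,\sigma}$ is a (smooth) connection form on the principal $\tilde K$-bundle $J\to P$, and on the space of composable pairs $(j_1,j_2)\in J\times J$, $\pi_2\rho(j_1)=\pi_1\rho(j_2)$, with first and second projections $\mathrm{pr}_{12},\mathrm{pr}_{23}$ and multiplication $m$ to $J$, $$\mathrm{pr}_{12}^*\nabla_{A,\sigma}+\mathrm{pr}_{23}^*\phi_{A,\sigma}=m^*\phi_{A,\sigma}.$$ Furthermore $$\phi_{A,\sigma}=\rho^*\pi_2^*\sigma(A)+\nabla_{A,\sigma}.$$ -/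

import Mathlib

open scoped Manifold ContDiff

noncomputable section

namespace LiftingGerbe

/-! ### Vector-valued one-forms -/

section OneForms

/-- One-forms on a manifold `M` with values in a topological vector space `V`, as (not necessarily
smooth) fields of continuous linear maps on the tangent spaces. -/
abbrev OneForm {E H : Type*} [NormedAddCommGroup E] [NormedSpace ℝ E] [TopologicalSpace H]
    (I : ModelWithCorners ℝ E H) (M : Type*) [TopologicalSpace M] [ChartedSpace H M]
    (V : Type*) [AddCommGroup V] [Module ℝ V] [TopologicalSpace V] : Type _ :=
  ∀ x : M, TangentSpace I x →L[ℝ] V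

/-- The pull-back `f^* α` of a one-form. -/
def pullback {E H E' H' M M' V : Type*}
    [NormedAddCommGroup E] [NormedSpace ℝ E] [TopologicalSpace H]
    [NormedAddCommGroup E'] [NormedSpace ℝ E'] [TopologicalSpace H']
    (I : ModelWithCorners ℝ E H) (I' : ModelWithCorners ℝ E' H')
    [TopologicalSpace M] [ChartedSpace H M] [TopologicalSpace M'] [ChartedSpace H' M']
    [AddCommGroup V] [Module ℝ V] [TopologicalSpace V]
    (f : M → M') (α : OneForm I' M' V) : OneForm I M V :=
  fun x => (α (f x)).comp (mfderiv I I' f x)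

/-- The one-form `L(α)` obtained by applying a continuous linear map `L` to the values of `α`. -/
def mapValues {E H M V W : Type*}
    [NormedAddCommGroup E] [NormedSpace ℝ E] [TopologicalSpace H]
    {I : ModelWithCorners ℝ E H} [TopologicalSpace M] [ChartedSpace H M]
    [AddCommGroup V] [Module ℝ V] [TopologicalSpace V]
    [AddCommGroup W] [Module ℝ W] [TopologicalSpace W]
    (L : V →L[ℝ] W) (α : OneForm I M V) : OneForm I M W :=
  fun x => L.comp (α x)

end OneForms

/-! ### Lie groups -/

section LieGroups

variable {E H : Type*} [NormedAddCommGroup E] [NormedSpace ℝ E] [TopologicalSpace H]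
  (I : ModelWithCorners ℝ E H) {G : Type*} [TopologicalSpace G] [ChartedSpace H G] [Group G]

/-- The adjoint action of a Lie group on its Lie algebra `T₁G`. -/
def Ad (g : G) : GroupLieAlgebra I G →L[ℝ] GroupLieAlgebra I G :=
  mfderiv I I (fun h : G => g * h * g⁻¹) 1

/-- The (left-invariant) Maurer-Cartan form `μ_g(v) = d(L_{g⁻¹})_g v` of a Lie group. -/
def maurerCartan : OneForm I G (GroupLieAlgebra I G) :=
  fun g => mfderiv I I (fun h : G => g⁻¹ * h) g

variable {I}

/-- Smoothness of a Lie algebra valued one-form: the associated function on the total space of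
the tangent bundle is smooth. (The Lie algebra `T₁G` is, as a topological vector space, the model
space `E`.) -/
def IsSmoothForm {E' H' M : Type*} [NormedAddCommGroup E'] [NormedSpace ℝ E']
    [TopologicalSpace H'] {I' : ModelWithCorners ℝ E' H'}
    [TopologicalSpace M] [ChartedSpace H' M] [IsManifold I' ∞ M]
    (α : OneForm I' M (GroupLieAlgebra I G)) : Prop :=
  ContMDiff I'.tangent 𝓘(ℝ, E) ∞ (fun v : TangentBundle I' M => show E from α v.proj v.2)

end LieGroups

/-! ### Principal bundles and their connections -/

section Principal

variable {EG HG G EP HP P EX HX X : Type*}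
  [NormedAddCommGroup EG] [NormedSpace ℝ EG] [TopologicalSpace HG]
  [NormedAddCommGroup EP] [NormedSpace ℝ EP] [TopologicalSpace HP]
  [NormedAddCommGroup EX] [NormedSpace ℝ EX] [TopologicalSpace HX]
  [TopologicalSpace G] [ChartedSpace HG G] [Group G]
  [TopologicalSpace P] [ChartedSpace HP P]
  [TopologicalSpace X] [ChartedSpace HX X]

/-- `proj : P → X` with the right action `act` of `G` on `P` is locally trivial: over a
neighbourhood `U` of any point there is a `G`-equivariant diffeomorphism `proj⁻¹(U) ≅ U × G`
over `U`. -/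
def IsLocallyTrivial (IG : ModelWithCorners ℝ EG HG) (IP : ModelWithCorners ℝ EP HP)
    (IX : ModelWithCorners ℝ EX HX) (proj : P → X) (act : P → G → P) : Prop :=
  ∀ x : X, ∃ (U : Set X) (Φ : OpenPartialHomeomorph P (X × G)),
    IsOpen U ∧ x ∈ U ∧ Φ.source = proj ⁻¹' U ∧ Φ.target = U ×ˢ Set.univ ∧
    ContMDiffOn IP (IX.prod IG) ∞ Φ Φ.source ∧
    ContMDiffOn (IX.prod IG) IP ∞ Φ.symm Φ.target ∧
    ∀ p ∈ Φ.source, (Φ p).1 = proj p ∧ ∀ g : G, Φ (act p g) = (proj p, (Φ p).2 * g)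

/-- A smooth principal `G`-bundle `P → X`, with `G` acting on the right. -/
structure PrincipalBundle (IG : ModelWithCorners ℝ EG HG) (IP : ModelWithCorners ℝ EP HP)
    (IX : ModelWithCorners ℝ EX HX) (G P X : Type*)
    [TopologicalSpace G] [ChartedSpace HG G] [Group G]
    [TopologicalSpace P] [ChartedSpace HP P]
    [TopologicalSpace X] [ChartedSpace HX X] where
  /-- the bundle projection -/
  proj : P → X
  /-- the right action -/
  act : P → G → P
  contMDiff_proj : ContMDiff IP IX ∞ proj
  contMDiff_act : ContMDiff (IP.prod IG) IP ∞ (fun z : P × G => act z.1 z.2)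
  act_one : ∀ p, act p 1 = p
  act_mul : ∀ p g h, act p (g * h) = act (act p g) h
  proj_act : ∀ p g, proj (act p g) = proj p
  locallyTrivial : IsLocallyTrivial IG IP IX proj act

variable {IG : ModelWithCorners ℝ EG HG} {IP : ModelWithCorners ℝ EP HP}
  {IX : ModelWithCorners ℝ EX HX}

/-- `α` is a (smooth) connection form on the principal bundle `B`: it reproduces the generators
of the fundamental vector fields and satisfies `R_g^* α = Ad_{g⁻¹} α`. -/
structure IsConnection [IsManifold IP ∞ P] (B : PrincipalBundle IG IP IX G P X)
    (α : OneForm IP P (GroupLieAlgebra IG G)) : Prop where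
  smooth : IsSmoothForm α
  vertical : ∀ (p : P) (ζ : GroupLieAlgebra IG G),
    α (B.act p 1) (mfderiv IG IP (fun g : G => B.act p g) 1 ζ) = ζ
  equivariant : ∀ g : G,
    pullback IP IP (fun p => B.act p g) α = mapValues (Ad IG g⁻¹) α

/-- `ε` is a (smooth) tensorial one-form of type `Ad` on the principal bundle `B`, that is, a
horizontal equivariant form; such forms are the same as one-forms on the base with values in the
adjoint bundle. -/
structure IsTensorial [IsManifold IP ∞ P] (B : PrincipalBundle IG IP IX G P X)
    (ε : OneForm IP P (GroupLieAlgebra IG G)) : Prop where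
  smooth : IsSmoothForm ε
  horizontal : ∀ (p : P) (v : TangentSpace IP p), mfderiv IP IX B.proj p v = 0 → ε p v = 0
  equivariant : ∀ g : G,
    pullback IP IP (fun p => B.act p g) ε = mapValues (Ad IG g⁻¹) ε

namespace PrincipalBundle

variable (B : PrincipalBundle IG IP IX G P X)

/-- The fibre product `P^{[2]} = P ×_X P`. -/
def FiberProduct : Type _ := {y : P × P // B.proj y.1 = B.proj y.2}

instance : TopologicalSpace B.FiberProduct :=
  inferInstanceAs (TopologicalSpace {y : P × P // B.proj y.1 = B.proj y.2})

/-- The projection of `P^{[2]}` to the first factor. -/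
def π₁ (y : B.FiberProduct) : P := y.1.1

/-- The projection of `P^{[2]}` to the second factor. -/
def π₂ (y : B.FiberProduct) : P := y.1.2

theorem continuous_π₁ : Continuous B.π₁ := continuous_fst.comp continuous_subtype_val

theorem continuous_π₂ : Continuous B.π₂ := continuous_snd.comp continuous_subtype_val

theorem existsUnique_act (p p' : P) (h : B.proj p = B.proj p') : ∃! g : G, B.act p g = p' := by
  obtain ⟨U, Φ, hU, hx, hs, ht, -, -, hΦ⟩ := B.locallyTrivial (B.proj p)
  have hp : p ∈ Φ.source := by rw [hs]; exact hx
  have hp' : p' ∈ Φ.source := by rw [hs, Set.mem_preimage, ← h]; exact hx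
  have ha : ∀ g, B.act p g ∈ Φ.source := fun g => by
    rw [hs, Set.mem_preimage, B.proj_act]; exact hx
  refine ⟨(Φ p).2⁻¹ * (Φ p').2, ?_, ?_⟩
  · apply Φ.injOn (ha _) hp'
    rw [(hΦ p hp).2]
    ext
    · simp [(hΦ p' hp').1, h]
    · simp
  · intro g hg
    have := (hΦ p hp).2 g
    rw [hg] at this
    rw [this]
    simp

/-- The map `ξ : P^{[2]} → G` with `ξ(p, p g) = g`. -/
def ξ (y : B.FiberProduct) : G := (B.existsUnique_act y.1.1 y.1.2 y.2).choose

theorem act_ξ (y : B.FiberProduct) : B.act (B.π₁ y) (B.ξ y) = B.π₂ y :=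
  (B.existsUnique_act y.1.1 y.1.2 y.2).choose_spec.1

theorem ξ_eq (y : B.FiberProduct) (g : G) (h : B.act (B.π₁ y) g = B.π₂ y) : B.ξ y = g :=
  ((B.existsUnique_act y.1.1 y.1.2 y.2).choose_spec.2 g h).symm

theorem continuous_ξ [IsTopologicalGroup G] : Continuous B.ξ := by
  rw [continuous_iff_continuousAt]
  intro y
  obtain ⟨U, Φ, hU, hx, hs, ht, -, -, hΦ⟩ := B.locallyTrivial (B.proj (B.π₁ y))
  have h1 : B.π₁ y ∈ Φ.source := by rw [hs]; exact hx
  have h2 : B.π₂ y ∈ Φ.source := by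
    rw [hs, Set.mem_preimage, show B.proj (B.π₂ y) = B.proj (B.π₁ y) from y.2.symm]; exact hx
  have hc : ContinuousAt (fun z => (Φ (B.π₁ z)).2⁻¹ * (Φ (B.π₂ z)).2) y :=
    ((Φ.continuousAt h1).comp B.continuous_π₁.continuousAt).snd.inv.mul
      ((Φ.continuousAt h2).comp B.continuous_π₂.continuousAt).snd
  refine hc.congr ?_
  filter_upwards [B.continuous_π₁.continuousAt (Φ.open_source.mem_nhds h1)] with y' hz
  have := (hΦ _ hz).2 (B.ξ y')
  rw [B.act_ξ] at this
  rw [this]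
  simp

/-- The homeomorphism `P × G ≅ P^{[2]}`, `(p, g) ↦ (p, p g)`. -/
def param [IsTopologicalGroup G] : P × G ≃ₜ B.FiberProduct where
  toFun z := ⟨(z.1, B.act z.1 z.2), (B.proj_act z.1 z.2).symm⟩
  invFun y := (B.π₁ y, B.ξ y)
  left_inv z := Prod.ext rfl (B.ξ_eq _ _ rfl)
  right_inv y := Subtype.ext (Prod.ext rfl (B.act_ξ y))
  continuous_toFun :=
    Continuous.subtype_mk (continuous_fst.prodMk B.contMDiff_act.continuous) _
  continuous_invFun := B.continuous_π₁.prodMk B.continuous_ξ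

/-- The smooth structure of the fibre product `P^{[2]}`: the one for which `(p, g) ↦ (p, p g)` is
a diffeomorphism from `P × G`. In terms of a local trivialization `P ≅ U × G` it is the product
structure of `P ×_X P ≅ U × G × G`. -/
instance [IsTopologicalGroup G] : ChartedSpace (ModelProd HP HG) B.FiberProduct :=
  letI : ChartedSpace (P × G) B.FiberProduct :=
    B.param.symm.toOpenPartialHomeomorph.singletonChartedSpace rfl
  ChartedSpace.comp (ModelProd HP HG) (P × G) B.FiberProduct

instance [IsManifold IP ∞ P] [IsManifold IG ∞ G] [IsTopologicalGroup G] :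
    IsManifold (IP.prod IG) ∞ B.FiberProduct where
  compatible := by
    rintro e e' ⟨f, hf, c, hc, rfl⟩ ⟨f', hf', c', hc', rfl⟩
    have h1 : f = B.param.symm.toOpenPartialHomeomorph := hf
    have h2 : f' = B.param.symm.toOpenPartialHomeomorph := hf'
    subst h1 h2
    refine (contDiffGroupoid ∞ (IP.prod IG)).mem_of_eqOnSource
      (HasGroupoid.compatible (G := contDiffGroupoid ∞ (IP.prod IG)) hc hc') ?_
    constructor
    · ext x; simp
    · intro x hx; simp

theorem contMDiff_param [IsManifold IP ∞ P] [IsManifold IG ∞ G] [IsTopologicalGroup G] :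
    ContMDiff (IP.prod IG) (IP.prod IG) ∞ B.param := by
  intro z
  rw [contMDiffAt_iff]
  refine ⟨B.param.continuous.continuousAt, ?_⟩
  have h := (contMDiffAt_iff.1 (contMDiffAt_id (I := IP.prod IG) (n := ∞) (x := z))).2
  convert h using 1
  funext x
  have : (chartAt (ModelProd HP HG) (B.param z)) =
    B.param.symm.toOpenPartialHomeomorph ≫ₕ
      chartAt (ModelProd HP HG) (B.param.symm (B.param z)) := rfl
  rw [extChartAt, this]
  simp [extChartAt]

theorem contMDiff_param_symm [IsManifold IP ∞ P] [IsManifold IG ∞ G] [IsTopologicalGroup G] :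
    ContMDiff (IP.prod IG) (IP.prod IG) ∞ B.param.symm := by
  intro y
  obtain ⟨z, rfl⟩ := B.param.surjective y
  rw [contMDiffAt_iff]
  refine ⟨B.param.symm.continuous.continuousAt, ?_⟩
  have h := (contMDiffAt_iff.1 (contMDiffAt_id (I := IP.prod IG) (n := ∞) (x := z))).2
  have : (chartAt (ModelProd HP HG) (B.param z)) =
    B.param.symm.toOpenPartialHomeomorph ≫ₕ
      chartAt (ModelProd HP HG) (B.param.symm (B.param z)) := rfl
  have h3 : extChartAt (IP.prod IG) (B.param z) (B.param z) = extChartAt (IP.prod IG) z z := by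
    rw [extChartAt, this]; simp [extChartAt]
  rw [h3]
  convert h using 1
  funext x
  rw [extChartAt, extChartAt, this]
  simp [extChartAt]

end PrincipalBundle

end Principal

/-! ### Central extensions -/

section Extensions

variable {EK HK K EL HL L : Type*}
  [NormedAddCommGroup EK] [NormedSpace ℝ EK] [TopologicalSpace HK]
  [NormedAddCommGroup EL] [NormedSpace ℝ EL] [TopologicalSpace HL]

/-- A central extension `1 → 𝕋 → L → K → 1` of Lie groups by the circle group `𝕋`; as usual for
Lie groups, `q : L → K` is required to be a (locally trivial) principal `𝕋`-bundle. -/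
structure CentralExtension (IL : ModelWithCorners ℝ EL HL) (IK : ModelWithCorners ℝ EK HK)
    (L K : Type*) [TopologicalSpace L] [ChartedSpace HL L] [Group L]
    [TopologicalSpace K] [ChartedSpace HK K] [Group K] where
  /-- the inclusion of the central circle -/
  ι : Circle →* L
  /-- the projection -/
  q : L →* K
  contMDiff_ι : ContMDiff (𝓡 1) IL ∞ ι
  contMDiff_q : ContMDiff IL IK ∞ q
  injective_ι : Function.Injective ι
  surjective_q : Function.Surjective q
  exact : ∀ l : L, q l = 1 ↔ ∃ z : Circle, ι z = l
  central : ∀ (z : Circle) (l : L), ι z * l = l * ι z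
  locallyTrivial : IsLocallyTrivial (𝓡 1) IL IK q (fun (l : L) (z : Circle) => l * ι z)

variable {IL : ModelWithCorners ℝ EL HL} {IK : ModelWithCorners ℝ EK HK}
  [TopologicalSpace L] [ChartedSpace HL L] [Group L]
  [TopologicalSpace K] [ChartedSpace HK K] [Group K]

namespace CentralExtension

variable (C : CentralExtension IL IK L K)

/-- The Lie algebra homomorphism `𝔩 → 𝔨` induced by `q`. Its kernel is the central ideal
`𝔱 = Lie 𝕋 ⊆ 𝔩`. -/
def dq : GroupLieAlgebra IL L →L[ℝ] GroupLieAlgebra IK K := mfderiv IL IK C.q 1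

/-- The adjoint action of `K` on `𝔩`: `Ad_k` is `Ad_l` for any lift `l ∈ L` of `k`. It does not
depend on the lift, see `adLift_q`, because `𝕋` is central. -/
def adLift (k : K) : GroupLieAlgebra IL L →L[ℝ] GroupLieAlgebra IL L :=
  Ad IL (C.surjective_q k).choose

theorem adLift_q (l : L) : C.adLift (C.q l) = Ad IL l := by
  have hs := (C.surjective_q (C.q l)).choose_spec
  set l' := (C.surjective_q (C.q l)).choose with hl'
  obtain ⟨z, hz⟩ := (C.exact (l⁻¹ * l')).1 (by rw [map_mul, map_inv, hs, inv_mul_cancel])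
  have h : l' = l * C.ι z := by rw [hz, mul_inv_cancel_left]
  have hf : (fun h : L => l' * h * l'⁻¹) = fun h : L => l * h * l⁻¹ := by
    funext x
    rw [h, mul_assoc l, C.central, mul_inv_rev]
    group
  change mfderiv IL IL (fun h : L => l' * h * l'⁻¹) 1 = mfderiv IL IL (fun h : L => l * h * l⁻¹) 1
  rw [hf]

/-- A splitting, as (topological) vector spaces, of `𝔩 → 𝔨`. -/
def IsSplitting (σ : GroupLieAlgebra IK K →L[ℝ] GroupLieAlgebra IL L) : Prop :=
  ∀ ζ, C.dq (σ ζ) = ζ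

variable (σ : GroupLieAlgebra IK K →L[ℝ] GroupLieAlgebra IL L)

/-- The connection `ν_σ = μ̃ - σ(q^* μ)` on the circle bundle `L → K`. Its values lie in
`𝔱 = ker dq ⊆ 𝔩`; it is regarded as an `𝔩`-valued form. -/
def ν : OneForm IL L (GroupLieAlgebra IL L) :=
  maurerCartan IL - mapValues σ (pullback IL IK C.q (maurerCartan IK))

/-- The group cocycle `Z_σ(k, ζ) = Ad_k σ(ζ) - σ(Ad_k ζ)`, with values in `𝔱 = ker dq ⊆ 𝔩`. -/
def Z (k : K) : GroupLieAlgebra IK K →L[ℝ] GroupLieAlgebra IL L :=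
  (C.adLift k).comp σ - σ.comp (Ad IK k)

end CentralExtension

end Extensions

/-! ### The lifting bundle gerbe -/

section Gerbe

variable {EK HK K EL HL L EP HP P EX HX X : Type*}
  [NormedAddCommGroup EK] [NormedSpace ℝ EK] [TopologicalSpace HK]
  [NormedAddCommGroup EL] [NormedSpace ℝ EL] [TopologicalSpace HL]
  [NormedAddCommGroup EP] [NormedSpace ℝ EP] [TopologicalSpace HP]
  [NormedAddCommGroup EX] [NormedSpace ℝ EX] [TopologicalSpace HX]
  {IK : ModelWithCorners ℝ EK HK} {IL : ModelWithCorners ℝ EL HL}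
  {IP : ModelWithCorners ℝ EP HP} {IX : ModelWithCorners ℝ EX HX}
  [TopologicalSpace K] [ChartedSpace HK K] [Group K]
  [TopologicalSpace L] [ChartedSpace HL L] [Group L]
  [TopologicalSpace P] [ChartedSpace HP P]
  [TopologicalSpace X] [ChartedSpace HX X]

/-- The total space `J = P × L` of the circle bundle `ρ : J → P^{[2]}` of the lifting bundle
gerbe. -/
abbrev J (P L : Type*) : Type _ := P × L

/-- The map `ξ̃ : J → L`. -/
def ξt (j : J P L) : L := j.2

/-- The map `ρ : J → P^{[2]}`, `(p, l) ↦ (p, p q(l))`. -/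
def ρ (C : CentralExtension IL IK L K) (B : PrincipalBundle IK IP IX K P X) (j : J P L) :
    B.FiberProduct :=
  ⟨(j.1, B.act j.1 (C.q j.2)), (B.proj_act j.1 (C.q j.2)).symm⟩

/-- `ρ` and `ξ̃` exhibit `J` as the pull-back `ξ^* L`. -/
theorem existsUnique_J (C : CentralExtension IL IK L K) (B : PrincipalBundle IK IP IX K P X)
    (y : B.FiberProduct) (l : L) :
    B.ξ y = C.q l ↔ ∃! j : J P L, ρ C B j = y ∧ ξt j = l := by
  constructor
  · intro h
    refine ⟨(B.π₁ y, l), ⟨Subtype.ext (Prod.ext rfl ?_), rfl⟩, ?_⟩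
    · change B.act (B.π₁ y) (C.q l) = B.π₂ y
      rw [← h, B.act_ξ]
    · rintro ⟨p, l'⟩ ⟨rfl, rfl⟩
      rfl
  · rintro ⟨⟨p, l'⟩, ⟨rfl, rfl⟩, -⟩
    exact B.ξ_eq _ _ rfl

/-- The space of composable pairs of elements of `J`, i.e. of pairs `((p, l₁), (p q(l₁), l₂))`,
parametrized by the triples `(p, l₁, l₂)`; see `existsUnique_composable`. -/
abbrev Composable (P L : Type*) : Type _ := P × L × L

/-- The first element of a composable pair. -/
def pr₁₂ (t : Composable P L) : J P L := (t.1, t.2.1)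

/-- The second element of a composable pair. -/
def pr₂₃ (C : CentralExtension IL IK L K) (B : PrincipalBundle IK IP IX K P X)
    (t : Composable P L) : J P L := (B.act t.1 (C.q t.2.1), t.2.2)

/-- The multiplication `((p, l₁), (p q(l₁), l₂)) ↦ (p, l₁ l₂)` of the lifting bundle gerbe. -/
def mult (t : Composable P L) : J P L := (t.1, t.2.1 * t.2.2)

theorem existsUnique_composable (C : CentralExtension IL IK L K)
    (B : PrincipalBundle IK IP IX K P X) (j j' : J P L) :
    B.π₂ (ρ C B j) = B.π₁ (ρ C B j') ↔
      ∃! t : Composable P L, pr₁₂ t = j ∧ pr₂₃ C B t = j' := by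
  obtain ⟨p, l⟩ := j
  obtain ⟨p', l'⟩ := j'
  constructor
  · intro h
    refine ⟨(p, l, l'), ⟨rfl, Prod.ext h rfl⟩, ?_⟩
    rintro ⟨a, b, c⟩ ⟨h1, h2⟩
    have h3 := congrArg Prod.fst h1
    have h4 := congrArg Prod.snd h1
    have h5 := congrArg Prod.snd h2
    simp only [pr₁₂, pr₂₃] at h3 h4 h5
    rw [h3, h4, h5]
  · rintro ⟨⟨a, b, c⟩, ⟨h1, h2⟩, -⟩
    have h3 := congrArg Prod.fst h1
    have h4 := congrArg Prod.snd h1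
    have h5 := congrArg Prod.fst h2
    simp only [pr₁₂, pr₂₃] at h3 h4 h5
    change B.act p (C.q l) = p'
    rw [← h3, ← h4, h5]

/-- The principal `L`-bundle `π₁ ∘ ρ : J → P`, with `L` acting by right multiplication. -/
def bundleJ [IsManifold IP ∞ P] [LieGroup IL ∞ L] :
    PrincipalBundle IL (IP.prod IL) IP L (J P L) P where
  proj j := j.1
  act j l := (j.1, j.2 * l)
  contMDiff_proj := contMDiff_fst
  contMDiff_act := (contMDiff_fst.comp contMDiff_fst).prodMk
    ((contMDiff_snd.comp contMDiff_fst).mul contMDiff_snd)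
  act_one p := by simp
  act_mul p g h := by simp [mul_assoc]
  proj_act p g := rfl
  locallyTrivial x := ⟨Set.univ, OpenPartialHomeomorph.refl (P × L), isOpen_univ, trivial, by simp,
    by simp, contMDiffOn_id, contMDiffOn_id, fun p _ => ⟨rfl, fun g => rfl⟩⟩

variable [IsTopologicalGroup K]
  (C : CentralExtension IL IK L K) (B : PrincipalBundle IK IP IX K P X)
  (A : OneForm IP P (GroupLieAlgebra IK K))
  (σ : GroupLieAlgebra IK K →L[ℝ] GroupLieAlgebra IL L)

/-- The one-form `Z_σ(ξ⁻¹, π₁^* A)` on `P^{[2]}`. -/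
def gomiCorrection : OneForm (IP.prod IK) B.FiberProduct (GroupLieAlgebra IL L) :=
  fun y => (C.Z σ (B.ξ y)⁻¹).comp (pullback (IP.prod IK) IP B.π₁ A y)

/-- The Gomi connection `∇_{A,σ} = ξ̃^* ν_σ + ρ^* Z_σ(ξ⁻¹, π₁^* A)` on `J → P^{[2]}`, regarded
as an `𝔩`-valued form through `𝔱 ⊆ 𝔩`. -/
def gomiConnection : OneForm (IP.prod IL) (J P L) (GroupLieAlgebra IL L) :=
  pullback (IP.prod IL) IL ξt (C.ν σ) +
    pullback (IP.prod IL) (IP.prod IK) (ρ C B) (gomiCorrection C B A σ)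

/-- The one-form `Ad_{ξ⁻¹} σ(π₁^* A)` on `P^{[2]}`. -/
def moduleCorrection : OneForm (IP.prod IK) B.FiberProduct (GroupLieAlgebra IL L) :=
  fun y => (C.adLift (B.ξ y)⁻¹).comp (mapValues σ (pullback (IP.prod IK) IP B.π₁ A) y)

/-- The form `φ_{A,σ} = ξ̃^* μ̃ + ρ^* Ad_{ξ⁻¹} σ(π₁^* A)` on `J`. -/
def moduleForm : OneForm (IP.prod IL) (J P L) (GroupLieAlgebra IL L) :=
  pullback (IP.prod IL) IL ξt (maurerCartan IL) +
    pullback (IP.prod IL) (IP.prod IK) (ρ C B) (moduleCorrection C B A σ)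

/-- `φ` is a (principal) bundle gerbe module connection on `J → P` compatible with the connection
`D` on the lifting bundle gerbe: it is a connection on the principal `L`-bundle `J → P`, and on the
space of composable pairs `pr₁₂^* D + pr₂₃^* φ = mult^* φ`. -/
structure IsModuleConnection [IsManifold IP ∞ P] [LieGroup IL ∞ L]
    (C : CentralExtension IL IK L K) (B : PrincipalBundle IK IP IX K P X)
    (D φ : OneForm (IP.prod IL) (J P L) (GroupLieAlgebra IL L)) : Prop where
  isConnection : IsConnection (bundleJ (IP := IP) (IL := IL) (P := P) (L := L)) φ
  compatible :
    pullback (IP.prod (IL.prod IL)) (IP.prod IL) pr₁₂ D +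
        pullback (IP.prod (IL.prod IL)) (IP.prod IL) (pr₂₃ C B) φ =
      pullback (IP.prod (IL.prod IL)) (IP.prod IL) mult φ

end Gerbe

end LiftingGerbe

end

open LiftingGerbe

/-! On `J = P × L` everything is explicit. At `(p, l)` and a tangent vector `(v, w)`, since `ξ (ρ
(p, l)) = q l`, the correction term is `Ad_{l⁻¹} σ(A v)`, so `φ = μ̃(w) + Ad_{l⁻¹} σ(A v)`. The
correction sees only `v` and transforms by `Ad_{(l g)⁻¹} = Ad_{g⁻¹} Ad_{l⁻¹}`, hence is tensorial.
The term `μ̃(w)` is the flat connection of the trivial bundle `P × L → P`, and a connection plus a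
tensorial form is a connection.

The connection properties of `A` give `(π₂ρ)^*A = Ad_{q(l)⁻¹} A v + μ(dq w)`. Applying `σ` yields
exactly the terms that `∇` subtracts from `φ`, whence `φ = σ(π₂^*A) + ∇`.

For compatibility at `(p, l₁, l₂)`, `dq ∘ ∇ = 0` because `σ` splits `dq`. The kernel of `dq` is
tangent to the central circle, so `Ad_{l₂⁻¹}` fixes `∇`. The left side thus becomes `μ̃(w₂) +
Ad_{l₂⁻¹}(∇ + σ(π₂^*A)) = μ̃(w₂) + Ad_{l₂⁻¹} φ(v, w₁)`, which is `φ` at `l₁ l₂` by the product rule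
for `μ̃`. The centrality step is `CentralExtension.modelAd_eq_self`; the formulas are
`modelForm_moduleForm` and `modelForm_gomiConnection`. -/

noncomputable section

namespace LiftingGerbe

/-! ### Derivatives in the model spaces -/

section ModelDerivative

variable {E H M E' H' M' E'' H'' M'' : Type*}
  [NormedAddCommGroup E] [NormedSpace ℝ E] [TopologicalSpace H]
  [NormedAddCommGroup E'] [NormedSpace ℝ E'] [TopologicalSpace H']
  [NormedAddCommGroup E''] [NormedSpace ℝ E''] [TopologicalSpace H'']
  (I : ModelWithCorners ℝ E H) (I' : ModelWithCorners ℝ E' H') (I'' : ModelWithCorners ℝ E'' H'')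
  [TopologicalSpace M] [ChartedSpace H M] [TopologicalSpace M'] [ChartedSpace H' M']
  [TopologicalSpace M''] [ChartedSpace H'' M'']

/-- The manifold derivative, as a continuous linear map between the model spaces. Its type does not
depend on the base point, so that one may rewrite the latter. -/
def modelDeriv (f : M → M') (x : M) : E →L[ℝ] E' := mfderiv I I' f x

variable {I I' I''}

theorem modelDeriv_comp {g : M' → M''} {f : M → M'} {x : M} (y : M')
    (hg : MDifferentiableAt I' I'' g y) (hf : MDifferentiableAt I I' f x) (hy : f x = y) (v : E) :
    modelDeriv I I'' (fun z => g (f z)) x v = modelDeriv I' I'' g y (modelDeriv I I' f x v) :=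
  mfderiv_comp_apply_of_eq x hg hf hy v

theorem modelDeriv_congr {f g : M → M'} {x : M} (h : f =ᶠ[nhds x] g) :
    modelDeriv I I' f x = modelDeriv I I' g x :=
  h.mfderiv_eq

theorem modelDeriv_prod {f : M × M' → M''} {x : M} {y : M'}
    (hf : MDifferentiableAt (I.prod I') I'' f (x, y)) (v : E) (w : E') :
    modelDeriv (I.prod I') I'' f (x, y) (v, w) =
      modelDeriv I I'' (fun z => f (z, y)) x v + modelDeriv I' I'' (fun z => f (x, z)) y w :=
  mfderiv_prod_eq_add_apply hf

theorem modelDeriv_prodMk {f : M → M'} {g : M → M''} {x : M}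
    (hf : MDifferentiableAt I I' f x) (hg : MDifferentiableAt I I'' g x) (v : E) :
    modelDeriv I (I'.prod I'') (fun z => (f z, g z)) x v =
      (modelDeriv I I' f x v, modelDeriv I I'' g x v) :=
  congrArg (fun T : E →L[ℝ] E' × E'' => T v) (mfderiv_prodMk hf hg)

theorem modelDeriv_id (x : M) (v : E) : modelDeriv I I (fun z : M => z) x v = v :=
  congrArg (fun T : E →L[ℝ] E => T v) (mfderiv_id (I := I) (x := x))

theorem modelDeriv_const (c : M') (x : M) (v : E) : modelDeriv I I' (fun _ : M => c) x v = 0 :=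
  congrArg (fun T : E →L[ℝ] E' => T v) (mfderiv_const (I := I) (I' := I') (x := x) (c := c))

theorem modelDeriv_fst (x : M × M') (v : E × E') :
    modelDeriv (I.prod I') I (fun z : M × M' => z.1) x v = v.1 :=
  congrArg (fun T : E × E' →L[ℝ] E => T v) (mfderiv_fst (I := I) (I' := I') (x := x))

theorem modelDeriv_snd (x : M × M') (v : E × E') :
    modelDeriv (I.prod I') I' (fun z : M × M' => z.2) x v = v.2 :=
  congrArg (fun T : E × E' →L[ℝ] E' => T v) (mfderiv_snd (I := I) (I' := I') (x := x))

/-- A curve in a single tangent space is smooth in the tangent bundle iff it is smooth in the model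
space. -/
theorem contMDiff_tangentBundle_fiber_iff [IsManifold I' ∞ M'] (c : M') (u : M → E') :
    ContMDiff I I'.tangent ∞ (fun t => (⟨c, u t⟩ : TangentBundle I' M')) ↔
      ContMDiff I 𝓘(ℝ, E') ∞ u := by
  -- The tangent bundle trivialization centred at `c` is the identity on the fibre over `c`, being
  -- the coordinate change of a chart with itself.
  have key : (fun t => (trivializationAt E' (TangentSpace I') c
      (⟨c, u t⟩ : TangentBundle I' M')).2) = u := by
    funext t
    exact (tangentBundleCore I' M').coordChange_self (achart H' c) c (mem_chart_source H' c) (u t)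
  constructor
  · intro h t
    have := (Bundle.contMDiffAt_totalSpace.1 (h t)).2
    simpa only [key] using this
  · intro h t
    refine Bundle.contMDiffAt_totalSpace.2 ⟨contMDiffAt_const, ?_⟩
    simpa only [key] using h t

/-- The partial derivative of a smooth map is smooth where the map itself is constant. -/
theorem contMDiff_modelDeriv_right {ET HT T : Type*} [NormedAddCommGroup ET] [NormedSpace ℝ ET]
    [TopologicalSpace HT] {IT : ModelWithCorners ℝ ET HT} [TopologicalSpace T] [ChartedSpace HT T]
    [IsManifold I ∞ M] [IsManifold I' ∞ M'] [IsManifold I'' ∞ M'']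
    {f : M × M' → M''} (hf : ContMDiff (I.prod I') I'' ∞ f)
    {a : T → M} (ha : ContMDiff IT I ∞ a)
    {b : T → TangentBundle I' M'} (hb : ContMDiff IT I'.tangent ∞ b)
    (c : M'') (hc : ∀ t, f (a t, (b t).proj) = c) :
    ContMDiff IT 𝓘(ℝ, E'') ∞
      (fun t => modelDeriv I' I'' (fun y => f (a t, y)) (b t).proj (b t).2) := by
  rw [← contMDiff_tangentBundle_fiber_iff (I' := I'') c]
  -- Pairing `b` with the zero vector over `a` turns the full tangent map of `f` into the partial
  -- derivative in the second variable.
  have h0 : ContMDiff IT I.tangent ∞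
      (fun t => Bundle.zeroSection E (TangentSpace I : M → Type _) (a t)) :=
    (Bundle.contMDiff_zeroSection ℝ (TangentSpace I : M → Type _)).comp ha
  have h := (hf.contMDiff_tangentMap (m := ∞) le_rfl).comp
    (contMDiff_equivTangentBundleProd_symm.comp (h0.prodMk hb))
  convert h using 1
  funext t
  have e := modelDeriv_prod ((hf (a t, (b t).proj)).mdifferentiableAt (by simp)) 0 (b t).2
  rw [map_zero, zero_add] at e
  rw [← e, ← hc t]
  rfl

end ModelDerivative

/-! ### The adjoint action and the Maurer-Cartan form -/

section LieGroups

variable {E H G : Type*} [NormedAddCommGroup E] [NormedSpace ℝ E] [TopologicalSpace H]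
  {I : ModelWithCorners ℝ E H} [TopologicalSpace G] [ChartedSpace H G] [Group G]

/-- The adjoint action, as a map from the model space to itself. -/
def modelAd (I : ModelWithCorners ℝ E H) (g : G) : E →L[ℝ] E := Ad I g

/-- The Maurer-Cartan form, as a map from the model space to itself. -/
def modelMC (I : ModelWithCorners ℝ E H) (g : G) : E →L[ℝ] E := maurerCartan I g

theorem modelMC_def (g : G) : modelMC I g = modelDeriv I I (fun h => g⁻¹ * h) g := rfl

theorem modelAd_def (g : G) : modelAd I g = modelDeriv I I (fun h => g * h * g⁻¹) 1 := rfl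

theorem modelMC_one (v : E) : modelMC I (1 : G) v = v := by
  have e : (fun h : G => (1 : G)⁻¹ * h) = fun h => h := by funext h; simp
  rw [modelMC_def, e, modelDeriv_id]

variable [LieGroup I ∞ G]

theorem mdifferentiableAt_mul_left' (g x : G) : MDifferentiableAt I I (fun h : G => g * h) x :=
  (contMDiff_mul_left (I := I) (n := ∞) (a := g)).mdifferentiable (by simp) x

theorem mdifferentiableAt_mul_right' (g x : G) : MDifferentiableAt I I (fun h : G => h * g) x :=
  (contMDiff_mul_right (I := I) (n := ∞) (a := g)).mdifferentiable (by simp) x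

theorem mdifferentiableAt_conj (g x : G) :
    MDifferentiableAt I I (fun h : G => g * h * g⁻¹) x :=
  (mdifferentiableAt_mul_right' g⁻¹ (g * x)).comp x (mdifferentiableAt_mul_left' g x)

theorem modelAd_mul (g h : G) (v : E) :
    modelAd I (g * h) v = modelAd I g (modelAd I h v) := by
  have e : (fun x : G => g * h * x * (g * h)⁻¹) = fun x => g * (h * x * h⁻¹) * g⁻¹ := by
    funext x; group
  rw [modelAd_def, e]
  exact modelDeriv_comp 1 (mdifferentiableAt_conj g 1) (mdifferentiableAt_conj h 1) (by simp) v

theorem modelMC_modelDeriv_mul_left (g x : G) (v : E) :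
    modelMC I (g * x) (modelDeriv I I (fun h : G => g * h) x v) = modelMC I x v := by
  rw [modelMC_def, ← modelDeriv_comp (g * x) (mdifferentiableAt_mul_left' _ _)
    (mdifferentiableAt_mul_left' _ _) rfl, modelMC_def]
  congr 2
  funext h
  group

/-- Differentiate `(x g)⁻¹ (h g) = g⁻¹ (x⁻¹ h) g` in `h` at `x`. -/
theorem modelMC_modelDeriv_mul_right (g x : G) (v : E) :
    modelMC I (x * g) (modelDeriv I I (fun h : G => h * g) x v) =
      modelAd I g⁻¹ (modelMC I x v) := by
  rw [modelMC_def, ← modelDeriv_comp (x * g) (mdifferentiableAt_mul_left' _ _)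
    (mdifferentiableAt_mul_right' _ _) rfl, modelMC_def, modelAd_def,
    ← modelDeriv_comp 1 (mdifferentiableAt_conj _ _) (mdifferentiableAt_mul_left' _ _) (by simp)]
  congr 2
  funext h
  group

/-- The inverse of `a t` is the form in which `Ad` enters the connection. Conjugation fixes `1`, so
this is a partial derivative of a smooth map along points where that map is constant. -/
theorem contMDiff_modelAd_inv {ET HT T : Type*} [NormedAddCommGroup ET] [NormedSpace ℝ ET]
    [TopologicalSpace HT] {IT : ModelWithCorners ℝ ET HT} [TopologicalSpace T] [ChartedSpace HT T]
    {a : T → G} (ha : ContMDiff IT I ∞ a) {u : T → E} (hu : ContMDiff IT 𝓘(ℝ, E) ∞ u) :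
    ContMDiff IT 𝓘(ℝ, E) ∞ (fun t => modelAd I (a t)⁻¹ (u t)) := by
  have : IsManifold I ∞ G := LieGroup.toContMDiffMul.toIsManifold
  have hf : ContMDiff (I.prod I) I ∞ (fun z : G × G => z.1⁻¹ * z.2 * z.1⁻¹⁻¹) :=
    ((contMDiff_fst.inv).mul contMDiff_snd).mul contMDiff_fst.inv.inv
  exact contMDiff_modelDeriv_right hf ha
    ((contMDiff_tangentBundle_fiber_iff (1 : G) u).2 hu) 1 (fun t => by simp)

theorem contMDiff_modelMC {ET HT T : Type*} [NormedAddCommGroup ET] [NormedSpace ℝ ET]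
    [TopologicalSpace HT] {IT : ModelWithCorners ℝ ET HT} [TopologicalSpace T] [ChartedSpace HT T]
    {b : T → TangentBundle I G} (hb : ContMDiff IT I.tangent ∞ b) :
    ContMDiff IT 𝓘(ℝ, E) ∞ (fun t => modelMC I (b t).proj (b t).2) := by
  have : IsManifold I ∞ G := LieGroup.toContMDiffMul.toIsManifold
  have hf : ContMDiff (I.prod I) I ∞ (fun z : G × G => z.1⁻¹ * z.2) :=
    contMDiff_fst.inv.mul contMDiff_snd
  have ha : ContMDiff IT I ∞ (fun t => (b t).proj) :=
    (Bundle.contMDiff_proj (TangentSpace I : G → Type _)).comp hb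
  exact contMDiff_modelDeriv_right hf ha hb 1 (fun t => by simp)

end LieGroups

/-! ### Central extensions -/

namespace CentralExtension

variable {EK HK K EL HL L : Type*}
  [NormedAddCommGroup EK] [NormedSpace ℝ EK] [TopologicalSpace HK]
  [NormedAddCommGroup EL] [NormedSpace ℝ EL] [TopologicalSpace HL]
  {IL : ModelWithCorners ℝ EL HL} {IK : ModelWithCorners ℝ EK HK}
  [TopologicalSpace L] [ChartedSpace HL L] [Group L]
  [TopologicalSpace K] [ChartedSpace HK K] [Group K]
  (C : CentralExtension IL IK L K)

theorem mdifferentiableAt_q (l : L) : MDifferentiableAt IL IK C.q l :=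
  C.contMDiff_q.mdifferentiable (by simp) l

theorem mdifferentiableAt_ι (z : Circle) : MDifferentiableAt (𝓡 1) IL C.ι z :=
  C.contMDiff_ι.mdifferentiable (by simp) z

theorem modelDeriv_q_modelMC [LieGroup IL ∞ L] [LieGroup IK ∞ K] (l : L) (v : EL) :
    modelDeriv IL IK C.q 1 (modelMC IL l v) = modelMC IK (C.q l) (modelDeriv IL IK C.q l v) := by
  rw [modelMC_def, modelMC_def, ← modelDeriv_comp 1 (C.mdifferentiableAt_q 1)
    (mdifferentiableAt_mul_left' _ _) (by simp), ← modelDeriv_comp (C.q l)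
    (mdifferentiableAt_mul_left' _ _) (C.mdifferentiableAt_q l) rfl]
  simp only [map_mul, map_inv]

theorem modelDeriv_q_modelAd [LieGroup IL ∞ L] [LieGroup IK ∞ K] (l : L) (v : EL) :
    modelDeriv IL IK C.q 1 (modelAd IL l v) = modelAd IK (C.q l) (modelDeriv IL IK C.q 1 v) := by
  rw [modelAd_def, modelAd_def, ← modelDeriv_comp 1 (C.mdifferentiableAt_q 1)
    (mdifferentiableAt_conj _ _) (by simp), ← modelDeriv_comp 1
    (mdifferentiableAt_conj _ _) (C.mdifferentiableAt_q 1) (by simp)]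
  simp only [map_mul, map_inv]

/-- The kernel of `dq` is the tangent space of the central circle. -/
theorem exists_modelDeriv_ι_eq (v : EL) (hv : modelDeriv IL IK C.q 1 v = 0) :
    ∃ (z₀ : Circle) (w : EuclideanSpace ℝ (Fin 1)),
      modelDeriv (𝓡 1) IL (fun z => C.ι (z₀⁻¹ * z)) z₀ w = v := by
  obtain ⟨U, Φ, hU, h1U, hs, ht, hΦ, hΨ, hact⟩ := C.locallyTrivial 1
  have h1 : (1 : L) ∈ Φ.source := by rw [hs, Set.mem_preimage, map_one]; exact h1U
  have hΦ1 : MDifferentiableAt IL (IK.prod (𝓡 1)) Φ 1 :=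
    (hΦ.contMDiffAt (Φ.open_source.mem_nhds h1)).mdifferentiableAt (by simp)
  have hΨ1 : MDifferentiableAt (IK.prod (𝓡 1)) IL Φ.symm (Φ 1) :=
    (hΨ.contMDiffAt (Φ.open_target.mem_nhds (Φ.map_source h1))).mdifferentiableAt (by simp)
  have hq1 : (Φ 1).1 = C.q 1 := (hact 1 h1).1
  -- The base component of `Φ` agrees with `q` near `1`, so its derivative kills `v` and only the
  -- circle component survives.
  have hΦe : modelDeriv IL (IK.prod (𝓡 1)) Φ 1 v =
      (0, modelDeriv IL (𝓡 1) (fun x => (Φ x).2) 1 v) := by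
    refine Prod.ext ?_ ?_
    · rw [← modelDeriv_fst (I := IK) (I' := 𝓡 1) (Φ 1),
        ← modelDeriv_comp (I' := IK.prod (𝓡 1)) (Φ 1) mdifferentiableAt_fst hΦ1 rfl, ← hv]
      refine DFunLike.congr_fun (modelDeriv_congr ?_) v
      filter_upwards [Φ.open_source.mem_nhds h1] with x hx using (hact x hx).1
    · rw [← modelDeriv_snd (I := IK) (I' := 𝓡 1) (Φ 1),
        ← modelDeriv_comp (I' := IK.prod (𝓡 1)) (Φ 1) mdifferentiableAt_snd hΦ1 rfl]
  have hid : modelDeriv IL IL (fun x => Φ.symm (Φ x)) 1 v = v := by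
    refine Eq.trans ?_ (modelDeriv_id (I := IL) (1 : L) v)
    refine DFunLike.congr_fun (modelDeriv_congr ?_) _
    filter_upwards [Φ.open_source.mem_nhds h1] with x hx using Φ.left_inv hx
  -- The trivialization need not send `1` to circle coordinate `1`; the shift by `z₀ = (Φ 1).2`
  -- compensates, making `z ↦ ι (z₀⁻¹ z)` the vertical slice of `Φ.symm` through `Φ 1`.
  refine ⟨(Φ 1).2, modelDeriv IL (𝓡 1) (fun x => (Φ x).2) 1 v, ?_⟩
  have hfib : (fun z => C.ι ((Φ 1).2⁻¹ * z)) = fun z => Φ.symm ((Φ 1).1, z) := by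
    funext z
    have h := (hact 1 h1).2 ((Φ 1).2⁻¹ * z)
    simp only [mul_inv_cancel_left, one_mul] at h
    have hz : C.ι ((Φ 1).2⁻¹ * z) ∈ Φ.source := by
      rw [hs, Set.mem_preimage, (C.exact _).2 ⟨_, rfl⟩]; exact h1U
    rw [hq1, ← h, Φ.left_inv hz]
  rw [hfib]
  refine Eq.trans ?_ hid
  rw [modelDeriv_comp (Φ 1) hΨ1 hΦ1 rfl, hΦe]
  have h := modelDeriv_prod (x := (Φ 1).1) (y := (Φ 1).2) hΨ1 0
    (modelDeriv IL (𝓡 1) (fun x => (Φ x).2) 1 v)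
  rw [map_zero, zero_add] at h
  exact h.symm

/-- The adjoint action is trivial on the kernel of `dq`. -/
theorem modelAd_eq_self [LieGroup IL ∞ L] (l : L) (v : EL)
    (hv : modelDeriv IL IK C.q 1 v = 0) : modelAd IL l v = v := by
  obtain ⟨z₀, w, rfl⟩ := C.exists_modelDeriv_ι_eq v hv
  have hd : MDifferentiableAt (𝓡 1) IL (fun z => C.ι (z₀⁻¹ * z)) z₀ :=
    (C.mdifferentiableAt_ι _).comp z₀ (mdifferentiableAt_mul_left' _ _)
  rw [modelAd_def, ← modelDeriv_comp 1 (mdifferentiableAt_conj _ _) hd (by simp)]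
  congr 2
  funext z
  -- Conjugation fixes the central circle pointwise, hence also its velocity vectors.
  rw [← C.central, mul_inv_cancel_right]

end CentralExtension

/-! ### Principal connections -/

section Connections

variable {EK HK K EP HP P EX HX X : Type*}
  [NormedAddCommGroup EK] [NormedSpace ℝ EK] [TopologicalSpace HK]
  [NormedAddCommGroup EP] [NormedSpace ℝ EP] [TopologicalSpace HP]
  [NormedAddCommGroup EX] [NormedSpace ℝ EX] [TopologicalSpace HX]
  {IK : ModelWithCorners ℝ EK HK} {IP : ModelWithCorners ℝ EP HP}
  {IX : ModelWithCorners ℝ EX HX}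
  [TopologicalSpace K] [ChartedSpace HK K] [Group K]
  [TopologicalSpace P] [ChartedSpace HP P]
  [TopologicalSpace X] [ChartedSpace HX X]

/-- The value of a Lie algebra valued one-form, as a map between the model spaces. -/
def modelForm (A : OneForm IP P (GroupLieAlgebra IK K)) (p : P) : EP →L[ℝ] EK := A p

theorem oneForm_ext {α β : OneForm IP P (GroupLieAlgebra IK K)}
    (h : ∀ p v, modelForm α p v = modelForm β p v) : α = β :=
  funext fun p => ContinuousLinearMap.ext (h p)

theorem mdifferentiableAt_act_right (B : PrincipalBundle IK IP IX K P X) (p : P) (g : K) :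
    MDifferentiableAt IK IP (fun g => B.act p g) g :=
  (B.contMDiff_act.comp (contMDiff_const.prodMk contMDiff_id)).mdifferentiable (by simp) g

variable [IsManifold IP ∞ P] {B : PrincipalBundle IK IP IX K P X}
  {A : OneForm IP P (GroupLieAlgebra IK K)}

theorem IsConnection.modelForm_act_left (hA : IsConnection B A) (p : P) (g : K) (v : EP) :
    modelForm A (B.act p g) (modelDeriv IP IP (fun p => B.act p g) p v) =
      modelAd IK g⁻¹ (modelForm A p v) :=
  congrArg (fun α : OneForm IP P (GroupLieAlgebra IK K) => modelForm α p v) (hA.equivariant g)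

/-- Along the orbit, `p h = (p g)(g⁻¹ h)`, so a vector at `p g` is the fundamental vector generated
by its Maurer-Cartan value, which the connection reproduces. -/
theorem IsConnection.modelForm_act_right [LieGroup IK ∞ K] (hA : IsConnection B A) (p : P) (g : K)
    (w : EK) :
    modelForm A (B.act p g) (modelDeriv IK IP (fun g => B.act p g) g w) = modelMC IK g w := by
  have h : modelForm A (B.act (B.act p g) 1)
      (modelDeriv IK IP (fun h => B.act (B.act p g) h) 1 (modelMC IK g w)) = modelMC IK g w :=
    hA.vertical (B.act p g) (modelMC IK g w)
  rw [B.act_one] at h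
  rw [← h, modelMC_def, ← modelDeriv_comp 1 (mdifferentiableAt_act_right B _ _)
    (mdifferentiableAt_mul_left' _ _) (by simp)]
  simp only [← B.act_mul, mul_inv_cancel_left]

end Connections

/-! ### The module connection -/

section RightMultiplication

variable {EL HL L EP HP P : Type*}
  [NormedAddCommGroup EL] [NormedSpace ℝ EL] [TopologicalSpace HL]
  [NormedAddCommGroup EP] [NormedSpace ℝ EP] [TopologicalSpace HP]
  {IL : ModelWithCorners ℝ EL HL} {IP : ModelWithCorners ℝ EP HP}
  [TopologicalSpace L] [ChartedSpace HL L] [Group L] [LieGroup IL ∞ L]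
  [TopologicalSpace P] [ChartedSpace HP P]

theorem modelDeriv_mul_right_J (j : J P L) (g : L) (v : EP × EL) :
    modelDeriv (IP.prod IL) (IP.prod IL) (fun j : P × L => (j.1, j.2 * g)) j v =
      (v.1, modelDeriv IL IL (fun l => l * g) j.2 v.2) := by
  have hs : MDifferentiableAt (IP.prod IL) IL (fun j : P × L => j.2 * g) j :=
    (mdifferentiableAt_mul_right' g j.2).comp j mdifferentiableAt_snd
  rw [modelDeriv_prodMk mdifferentiableAt_fst hs, modelDeriv_fst,
    modelDeriv_comp j.2 (mdifferentiableAt_mul_right' g j.2) mdifferentiableAt_snd rfl,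
    modelDeriv_snd]

end RightMultiplication

section Gerbe

variable {EK HK K EL HL L EP HP P EX HX X : Type*}
  [NormedAddCommGroup EK] [NormedSpace ℝ EK] [TopologicalSpace HK]
  [NormedAddCommGroup EL] [NormedSpace ℝ EL] [TopologicalSpace HL]
  [NormedAddCommGroup EP] [NormedSpace ℝ EP] [TopologicalSpace HP]
  [NormedAddCommGroup EX] [NormedSpace ℝ EX] [TopologicalSpace HX]
  {IK : ModelWithCorners ℝ EK HK} {IL : ModelWithCorners ℝ EL HL}
  {IP : ModelWithCorners ℝ EP HP} {IX : ModelWithCorners ℝ EX HX}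
  [TopologicalSpace K] [ChartedSpace HK K] [Group K]
  [TopologicalSpace L] [ChartedSpace HL L] [Group L]
  [TopologicalSpace P] [ChartedSpace HP P]
  [TopologicalSpace X] [ChartedSpace HX X]
  (C : CentralExtension IL IK L K) (B : PrincipalBundle IK IP IX K P X)

theorem ξ_ρ (j : J P L) : B.ξ (ρ C B j) = C.q j.2 := B.ξ_eq _ _ rfl

variable [LieGroup IK ∞ K] [IsManifold IP ∞ P]

/-- The argument of `A` is the derivative of `(p, l) ↦ p q(l)`, so this computes the pull-back of
`A` along `π₂ ∘ ρ`. -/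
theorem IsConnection.modelForm_modelDeriv_act_q
    {A : OneForm IP P (GroupLieAlgebra IK K)} (hA : IsConnection B A) (j : J P L)
    (v : EP × EL) :
    modelForm A (B.act j.1 (C.q j.2))
      (modelDeriv IP IP (fun p => B.act p (C.q j.2)) j.1 v.1 +
        modelDeriv IK IP (fun k => B.act j.1 k) (C.q j.2) (modelDeriv IL IK C.q j.2 v.2)) =
      modelAd IK (C.q j.2)⁻¹ (modelForm A j.1 v.1) +
        modelMC IK (C.q j.2) (modelDeriv IL IK C.q j.2 v.2) := by
  rw [map_add, hA.modelForm_act_left, hA.modelForm_act_right]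

variable [IsTopologicalGroup K]

/-! ### Smoothness and derivatives of the maps between `J`, `P^{[2]}` and `P` -/

theorem contMDiff_π₁ : ContMDiff (IP.prod IK) IP ∞ B.π₁ := by
  have : IsManifold IK ∞ K := LieGroup.toContMDiffMul.toIsManifold
  have h := contMDiff_fst.comp (B.contMDiff_param_symm (IP := IP) (IG := IK))
  exact h

/-- Under the diffeomorphism `B.param` with `P × K`, the second projection becomes the action map.
-/
theorem contMDiff_π₂ : ContMDiff (IP.prod IK) IP ∞ B.π₂ := by
  have : IsManifold IK ∞ K := LieGroup.toContMDiffMul.toIsManifold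
  have h := B.contMDiff_act.comp (B.contMDiff_param_symm (IP := IP) (IG := IK))
  convert h using 1
  funext y
  exact (B.act_ξ y).symm

theorem contMDiff_ρ : ContMDiff (IP.prod IL) (IP.prod IK) ∞ (ρ C B) := by
  have : IsManifold IK ∞ K := LieGroup.toContMDiffMul.toIsManifold
  exact B.contMDiff_param.comp (contMDiff_fst.prodMk (C.contMDiff_q.comp contMDiff_snd))

theorem modelDeriv_π₁_ρ (j : J P L) (v : EP × EL) :
    modelDeriv (IP.prod IK) IP B.π₁ (ρ C B j)
      (modelDeriv (IP.prod IL) (IP.prod IK) (ρ C B) j v) = v.1 := by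
  rw [← modelDeriv_comp (ρ C B j) ((contMDiff_π₁ B).mdifferentiable (by simp) _)
    ((contMDiff_ρ C B).mdifferentiable (by simp) _) rfl]
  exact modelDeriv_fst j v

theorem modelDeriv_π₂_ρ (j : J P L) (v : EP × EL) :
    modelDeriv (IP.prod IK) IP B.π₂ (ρ C B j)
      (modelDeriv (IP.prod IL) (IP.prod IK) (ρ C B) j v) =
    modelDeriv IP IP (fun p => B.act p (C.q j.2)) j.1 v.1 +
      modelDeriv IK IP (fun k => B.act j.1 k) (C.q j.2) (modelDeriv IL IK C.q j.2 v.2) := by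
  rw [← modelDeriv_comp (ρ C B j) ((contMDiff_π₂ B).mdifferentiable (by simp) _)
    ((contMDiff_ρ C B).mdifferentiable (by simp) _) rfl]
  have hd : ContMDiff (IP.prod IL) IP ∞ (fun j : P × L => B.act j.1 (C.q j.2)) :=
    B.contMDiff_act.comp (contMDiff_fst.prodMk (C.contMDiff_q.comp contMDiff_snd))
  refine (modelDeriv_prod (x := j.1) (y := j.2) (hd.mdifferentiable (by simp) j) v.1 v.2).trans ?_
  rw [modelDeriv_comp (C.q j.2) (mdifferentiableAt_act_right B _ _) (C.mdifferentiableAt_q _) rfl]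

variable (A : OneForm IP P (GroupLieAlgebra IK K))
  (σ : GroupLieAlgebra IK K →L[ℝ] GroupLieAlgebra IL L)

/-- A linear map between Lie algebras, as a map between the model spaces. -/
def modelLinearMap (σ : GroupLieAlgebra IK K →L[ℝ] GroupLieAlgebra IL L) : EK →L[ℝ] EL := σ

/-! ### Pointwise formulas for the forms on `J` -/

theorem modelForm_moduleCorrection (j : J P L) (v : EP × EL) :
    modelForm (pullback (IP.prod IL) (IP.prod IK) (ρ C B) (moduleCorrection C B A σ)) j v =
      modelAd IL j.2⁻¹ (modelLinearMap σ (modelForm A j.1 v.1)) := by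
  -- Restating the value with model-space types, which do not depend on base points, makes the
  -- rewriting of `ξ (ρ j)` as `q j.2` type-correct.
  have h : modelForm (pullback (IP.prod IL) (IP.prod IK) (ρ C B) (moduleCorrection C B A σ)) j v =
      (C.adLift (B.ξ (ρ C B j))⁻¹ : EL →L[ℝ] EL) (modelLinearMap σ (modelForm A j.1
        (modelDeriv (IP.prod IK) IP B.π₁ (ρ C B j)
          (modelDeriv (IP.prod IL) (IP.prod IK) (ρ C B) j v)))) := rfl
  rw [h, modelDeriv_π₁_ρ, ξ_ρ, ← map_inv, C.adLift_q]
  rfl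

theorem modelForm_moduleForm (j : J P L) (v : EP × EL) :
    modelForm (moduleForm C B A σ) j v =
      modelMC IL j.2 v.2 + modelAd IL j.2⁻¹ (modelLinearMap σ (modelForm A j.1 v.1)) := by
  rw [← modelForm_moduleCorrection C B, ← modelDeriv_snd (I := IP) (I' := IL) j v]
  rfl

theorem modelForm_gomiConnection (j : J P L) (v : EP × EL) :
    modelForm (gomiConnection C B A σ) j v =
      modelMC IL j.2 v.2 -
          modelLinearMap σ (modelMC IK (C.q j.2) (modelDeriv IL IK C.q j.2 v.2)) +
        (modelAd IL j.2⁻¹ (modelLinearMap σ (modelForm A j.1 v.1)) -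
          modelLinearMap σ (modelAd IK (C.q j.2)⁻¹ (modelForm A j.1 v.1))) := by
  have h : modelForm (gomiConnection C B A σ) j v =
      modelMC IL j.2 (modelDeriv (IP.prod IL) IL (fun z : P × L => z.2) j v) -
          modelLinearMap σ (modelMC IK (C.q j.2) (modelDeriv IL IK C.q j.2
            (modelDeriv (IP.prod IL) IL (fun z : P × L => z.2) j v))) +
        modelLinearMap (C.Z σ (B.ξ (ρ C B j))⁻¹) (modelForm A j.1
          (modelDeriv (IP.prod IK) IP B.π₁ (ρ C B j)
            (modelDeriv (IP.prod IL) (IP.prod IK) (ρ C B) j v))) := rfl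
  rw [h, modelDeriv_π₁_ρ, modelDeriv_snd, ξ_ρ, ← map_inv, CentralExtension.Z, C.adLift_q]
  rfl

variable {A}

/-- The two terms that `gomiConnection` subtracts are `σ` of the two summands in the formula for `A`
pulled back by `π₂ ∘ ρ`. -/
theorem moduleForm_eq_add_gomiConnection (hA : IsConnection B A) :
    moduleForm C B A σ =
      pullback (IP.prod IL) (IP.prod IK) (ρ C B)
        (pullback (IP.prod IK) IP B.π₂ (mapValues σ A)) + gomiConnection C B A σ := by
  refine oneForm_ext fun j v => ?_
  have h : modelForm (moduleForm C B A σ) j v =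
      modelLinearMap σ (modelForm A (B.act j.1 (C.q j.2))
        (modelDeriv (IP.prod IK) IP B.π₂ (ρ C B j)
          (modelDeriv (IP.prod IL) (IP.prod IK) (ρ C B) j v))) +
        modelForm (gomiConnection C B A σ) j v := by
    rw [modelDeriv_π₂_ρ, hA.modelForm_modelDeriv_act_q, modelForm_moduleForm,
      modelForm_gomiConnection, map_add]
    abel
  exact h

variable [LieGroup IL ∞ L]

/-! ### Tensoriality, the connection axioms and compatibility -/

theorem isSmoothForm_moduleCorrection (hA : IsSmoothForm A) :
    IsSmoothForm
      (pullback (IP.prod IL) (IP.prod IK) (ρ C B) (moduleCorrection C B A σ)) := by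
  have : IsManifold IL ∞ L := LieGroup.toContMDiffMul.toIsManifold
  have h2 : ContMDiff (IP.prod IL).tangent IL ∞
      (fun v : TangentBundle (IP.prod IL) (P × L) => v.proj.2) :=
    contMDiff_snd.comp (Bundle.contMDiff_proj (TangentSpace (IP.prod IL) : P × L → Type _))
  have h1 : ContMDiff (IP.prod IL).tangent IP.tangent ∞
      (tangentMap (IP.prod IL) IP (Prod.fst : P × L → P)) :=
    contMDiff_fst.contMDiff_tangentMap le_rfl
  have h := contMDiff_modelAd_inv h2
    ((modelLinearMap σ).contDiff.contMDiff.comp (ContMDiff.comp hA h1))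
  unfold IsSmoothForm
  convert h using 1
  funext v
  refine (modelForm_moduleCorrection C B A σ v.proj v.2).trans ?_
  rw [← modelDeriv_fst (I := IP) (I' := IL) v.proj v.2]
  rfl

theorem isSmoothForm_moduleForm (hA : IsSmoothForm A) : IsSmoothForm (moduleForm C B A σ) := by
  have : IsManifold IL ∞ L := LieGroup.toContMDiffMul.toIsManifold
  have h1 : ContMDiff (IP.prod IL).tangent IL.tangent ∞
      (tangentMap (IP.prod IL) IL (Prod.snd : P × L → L)) :=
    contMDiff_snd.contMDiff_tangentMap le_rfl
  exact (contMDiff_modelMC h1).add (isSmoothForm_moduleCorrection C B σ hA)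

variable (A) in
theorem isTensorial_moduleCorrection (hA : IsSmoothForm A) :
    IsTensorial (bundleJ (IP := IP) (IL := IL) (P := P) (L := L))
      (pullback (IP.prod IL) (IP.prod IK) (ρ C B) (moduleCorrection C B A σ)) where
  smooth := isSmoothForm_moduleCorrection C B σ hA
  horizontal := by
    intro j (v : EP × EL) hv
    -- The projection `J → P` is the first factor, so verticality means that the `P`-component
    -- vanishes, and the correction depends on nothing else.
    have hv' : modelDeriv (IP.prod IL) IP (fun z : P × L => z.1) j v = 0 := hv
    rw [modelDeriv_fst] at hv'
    refine (modelForm_moduleCorrection C B A σ j v).trans ?_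
    rw [hv', map_zero, map_zero, map_zero]
    rfl
  equivariant g := by
    refine oneForm_ext fun j v => ?_
    have h : modelForm (pullback (IP.prod IL) (IP.prod IK) (ρ C B) (moduleCorrection C B A σ))
        (j.1, j.2 * g)
        (modelDeriv (IP.prod IL) (IP.prod IL) (fun j : P × L => (j.1, j.2 * g)) j v) =
      modelAd IL g⁻¹ (modelForm (pullback (IP.prod IL) (IP.prod IK) (ρ C B)
        (moduleCorrection C B A σ)) j v) := by
      rw [modelForm_moduleCorrection, modelForm_moduleCorrection, modelDeriv_mul_right_J,
        mul_inv_rev, modelAd_mul]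
    exact h

variable (A) in
theorem isConnection_moduleForm (hA : IsSmoothForm A) :
    IsConnection (bundleJ (IP := IP) (IL := IL) (P := P) (L := L)) (moduleForm C B A σ) where
  smooth := isSmoothForm_moduleForm C B σ hA
  vertical := by
    intro j (ζ : EL)
    have h : modelForm (moduleForm C B A σ) (j.1, j.2 * 1)
        (modelDeriv IL (IP.prod IL) (fun g : L => (j.1, j.2 * g)) 1 ζ) = ζ := by
      -- A fundamental vector has zero `P`-component, so only the Maurer-Cartan term contributes; by
      -- left invariance its value is that at `1`, the identity.
      rw [modelDeriv_prodMk mdifferentiableAt_const (mdifferentiableAt_mul_left' _ _),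
        modelForm_moduleForm, modelDeriv_const, map_zero, map_zero, map_zero, add_zero,
        modelMC_modelDeriv_mul_left, modelMC_one]
    exact h
  equivariant g := by
    refine oneForm_ext fun j v => ?_
    have h : modelForm (moduleForm C B A σ) (j.1, j.2 * g)
        (modelDeriv (IP.prod IL) (IP.prod IL) (fun j : P × L => (j.1, j.2 * g)) j v) =
      modelAd IL g⁻¹ (modelForm (moduleForm C B A σ) j v) := by
      rw [modelForm_moduleForm, modelForm_moduleForm, modelDeriv_mul_right_J, mul_inv_rev,
        modelAd_mul, modelMC_modelDeriv_mul_right, map_add]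
    exact h

variable {σ}

/-- The Gomi connection takes values in the kernel of `dq`. -/
theorem modelDeriv_q_gomiConnection (hσ : C.IsSplitting σ) (j : J P L) (v : EP × EL) :
    modelDeriv IL IK C.q 1 (modelForm (gomiConnection C B A σ) j v) = 0 := by
  have hσ' : ∀ ζ : EK, modelDeriv IL IK C.q 1 (modelLinearMap σ ζ) = ζ := hσ
  -- Since `dq` intertwines the Maurer-Cartan forms and adjoint actions of `L` and `K`, the terms
  -- cancel in pairs: one pair from `ν`, the other from `Z`.
  rw [modelForm_gomiConnection, map_add, map_sub, map_sub, hσ', hσ', C.modelDeriv_q_modelMC,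
    C.modelDeriv_q_modelAd, hσ', map_inv, sub_self, sub_self, add_zero]

theorem isModuleConnection_moduleForm (hA : IsConnection B A) (hσ : C.IsSplitting σ) :
    IsModuleConnection C B (gomiConnection C B A σ) (moduleForm C B A σ) where
  isConnection := isConnection_moduleForm C B A σ hA.smooth
  compatible := by
    refine oneForm_ext fun t v => ?_
    obtain ⟨p, l₁, l₂⟩ := t
    obtain ⟨v, w₁, w₂⟩ := v
    have hl₁ : MDifferentiableAt (IP.prod (IL.prod IL)) IL
        (fun t : P × L × L => t.2.1) (p, l₁, l₂) :=
      mdifferentiableAt_fst.comp _ mdifferentiableAt_snd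
    have hl₂ : MDifferentiableAt (IP.prod (IL.prod IL)) IL
        (fun t : P × L × L => t.2.2) (p, l₁, l₂) :=
      mdifferentiableAt_snd.comp _ mdifferentiableAt_snd
    have d₁ : modelDeriv (IP.prod (IL.prod IL)) IL (fun t : P × L × L => t.2.1) (p, l₁, l₂)
        (v, w₁, w₂) = w₁ := by
      rw [modelDeriv_comp (l₁, l₂) mdifferentiableAt_fst mdifferentiableAt_snd rfl,
        modelDeriv_fst, modelDeriv_snd]
    have d₂ : modelDeriv (IP.prod (IL.prod IL)) IL (fun t : P × L × L => t.2.2) (p, l₁, l₂)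
        (v, w₁, w₂) = w₂ := by
      rw [modelDeriv_comp (l₁, l₂) mdifferentiableAt_snd mdifferentiableAt_snd rfl,
        modelDeriv_snd, modelDeriv_snd]
    have d₁₂ : modelDeriv (IP.prod (IL.prod IL)) (IP.prod IL) pr₁₂ (p, l₁, l₂) (v, w₁, w₂) =
        (v, w₁) := by
      refine (modelDeriv_prodMk mdifferentiableAt_fst hl₁ _).trans ?_
      rw [modelDeriv_fst, d₁]
    have hact : ContMDiff (IP.prod IL) IP ∞ (fun j : P × L => B.act j.1 (C.q j.2)) :=
      B.contMDiff_act.comp (contMDiff_fst.prodMk (C.contMDiff_q.comp contMDiff_snd))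
    have hpr : MDifferentiableAt (IP.prod (IL.prod IL)) (IP.prod IL)
        (pr₁₂ : P × L × L → P × L) (p, l₁, l₂) := mdifferentiableAt_fst.prodMk hl₁
    have hact' : MDifferentiableAt (IP.prod (IL.prod IL)) IP
        (fun t : P × L × L => B.act t.1 (C.q t.2.1)) (p, l₁, l₂) :=
      (hact.mdifferentiable (by simp) (p, l₁)).comp (p, l₁, l₂) hpr
    have d₂₃ : modelDeriv (IP.prod (IL.prod IL)) (IP.prod IL) (pr₂₃ C B) (p, l₁, l₂)
        (v, w₁, w₂) =
        (modelDeriv IP IP (fun p => B.act p (C.q l₁)) p v +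
          modelDeriv IK IP (fun k => B.act p k) (C.q l₁) (modelDeriv IL IK C.q l₁ w₁), w₂) := by
      refine (modelDeriv_prodMk hact' hl₂ _).trans ?_
      rw [d₂]
      refine congrArg (fun x => (x, w₂)) ?_
      refine (modelDeriv_comp (f := pr₁₂) (p, l₁) (hact.mdifferentiable (by simp) (p, l₁)) hpr rfl
        _).trans ?_
      rw [d₁₂, modelDeriv_prod (hact.mdifferentiable (by simp) (p, l₁)),
        modelDeriv_comp (C.q l₁) (mdifferentiableAt_act_right B _ _) (C.mdifferentiableAt_q _) rfl]
    have hmul : MDifferentiableAt (IL.prod IL) IL (fun z : L × L => z.1 * z.2) (l₁, l₂) :=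
      (contMDiff_mul IL ∞).mdifferentiable (by simp) _
    have hmul' : MDifferentiableAt (IP.prod (IL.prod IL)) IL
        (fun t : P × L × L => t.2.1 * t.2.2) (p, l₁, l₂) :=
      hmul.comp (p, l₁, l₂) mdifferentiableAt_snd
    have dm : modelDeriv (IP.prod (IL.prod IL)) (IP.prod IL) mult (p, l₁, l₂) (v, w₁, w₂) =
        (v, modelDeriv IL IL (fun l => l * l₂) l₁ w₁ +
          modelDeriv IL IL (fun l => l₁ * l) l₂ w₂) := by
      refine (modelDeriv_prodMk mdifferentiableAt_fst hmul' _).trans ?_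
      rw [modelDeriv_fst, modelDeriv_comp (l₁, l₂) hmul mdifferentiableAt_snd rfl, modelDeriv_snd,
        modelDeriv_prod hmul]
    have h : modelForm (gomiConnection C B A σ) (p, l₁)
          (modelDeriv (IP.prod (IL.prod IL)) (IP.prod IL) pr₁₂ (p, l₁, l₂) (v, w₁, w₂)) +
        modelForm (moduleForm C B A σ) (B.act p (C.q l₁), l₂)
          (modelDeriv (IP.prod (IL.prod IL)) (IP.prod IL) (pr₂₃ C B) (p, l₁, l₂) (v, w₁, w₂)) =
        modelForm (moduleForm C B A σ) (p, l₁ * l₂)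
          (modelDeriv (IP.prod (IL.prod IL)) (IP.prod IL) mult (p, l₁, l₂) (v, w₁, w₂)) := by
      -- The value of the Gomi connection is central, so `Ad_{l₂⁻¹}` may be inserted in front of it;
      -- this matches the `Ad_{l₂⁻¹}` in the correction term at `(p q(l₁), l₂)`.
      rw [d₁₂, d₂₃, dm, ← C.modelAd_eq_self l₂⁻¹ _ (modelDeriv_q_gomiConnection C B hσ _ _),
        modelForm_gomiConnection, modelForm_moduleForm, modelForm_moduleForm]
      have hq := hA.modelForm_modelDeriv_act_q C B (p, l₁) (v, w₁)
      dsimp only at hq ⊢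
      rw [hq, map_add (modelMC IL (l₁ * l₂)), modelMC_modelDeriv_mul_left, modelMC_modelDeriv_mul_right, mul_inv_rev,
        modelAd_mul]
      -- Under `Ad_{l₂⁻¹}`, the terms `σ(μ(dq w₁))` and `σ(Ad_{q(l₁)⁻¹} A v)` occur once with each
      -- sign and cancel.
      simp only [map_add, map_sub]
      abel
    exact h

end Gerbe

end LiftingGerbe

end

theorem mainTheorem10
    {EK HK K EL HL L EP HP P EX HX X : Type*}
    [NormedAddCommGroup EK] [NormedSpace ℝ EK] [TopologicalSpace HK]
    [NormedAddCommGroup EL] [NormedSpace ℝ EL] [TopologicalSpace HL]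
    [NormedAddCommGroup EP] [NormedSpace ℝ EP] [TopologicalSpace HP]
    [NormedAddCommGroup EX] [NormedSpace ℝ EX] [TopologicalSpace HX]
    {IK : ModelWithCorners ℝ EK HK} {IL : ModelWithCorners ℝ EL HL}
    {IP : ModelWithCorners ℝ EP HP} {IX : ModelWithCorners ℝ EX HX}
    [TopologicalSpace K] [ChartedSpace HK K] [Group K] [LieGroup IK ∞ K] [IsTopologicalGroup K]
    [TopologicalSpace L] [ChartedSpace HL L] [Group L] [LieGroup IL ∞ L]
    [TopologicalSpace P] [ChartedSpace HP P] [IsManifold IP ∞ P]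
    [TopologicalSpace X] [ChartedSpace HX X] [IsManifold IX ∞ X]
    (C : CentralExtension IL IK L K) (B : PrincipalBundle IK IP IX K P X)
    (A : OneForm IP P (GroupLieAlgebra IK K)) (hA : IsConnection B A)
    (σ : GroupLieAlgebra IK K →L[ℝ] GroupLieAlgebra IL L) (hσ : C.IsSplitting σ) :
    IsTensorial (bundleJ (IP := IP) (IL := IL) (P := P) (L := L))
      (pullback (IP.prod IL) (IP.prod IK) (ρ C B) (moduleCorrection C B A σ)) ∧
    IsModuleConnection C B (gomiConnection C B A σ) (moduleForm C B A σ) ∧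
    moduleForm C B A σ =
      pullback (IP.prod IL) (IP.prod IK) (ρ C B)
        (pullback (IP.prod IK) IP B.π₂ (mapValues σ A)) + gomiConnection C B A σ := by
  exact ⟨isTensorial_moduleCorrection C B A σ hA.smooth, isModuleConnection_moduleForm C B hA hσ,
    moduleForm_eq_add_gomiConnection C B σ hA⟩
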